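/- Let $n\ge 2$ and $m\ge 1$, let $U\subset\mathbb C^n$ be an open neighbourhood of $0$, and let $F=(f_1,\dots,f_m):U\to\mathbb C^m$ be holomorphic with $F(0)=0$. Let $|\cdot|$ denote the maximum norm on $\mathbb C^n$ and $\mathbb C^m$. For $T\subset U$ let $N(F|T)$ be the set of all real $\nu\ge 0$ for which there exist $A>0$ and $B>0$ such that $A|z|^\nu\le|F(z)|$ for all $z\in T$ with $|z|<B$ (with $0^0=1$). Define the local Łojasiewicz exponent $\mathcal L_0(F|T):=\inf N(F|T)\in[0,\infty]$, where $\inf\emptyset=\infty$, and put $\mathcal L_0(F):=\mathcal L_0(F|U)$. If $$S:=\{z\in U: f_1(z)\cdot\ldots\cdot f_m(z)=0\},$$ then $$\mathcal L_0(F)=\mathcal L_0(F|S).$$ -/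

import Mathlib

open scoped NNReal ENNReal

/-- The set `N(F|S)` of all real `ν ≥ 0` for which there are `A, B > 0` such that
`A |z| ^ ν ≤ |F z|` for all `z ∈ S` with `|z| < B`. The norm on `Fin k → ℂ` is the
maximum (polycylindric) norm. -/
def lojasiewiczSet {n m : ℕ} (F : (Fin n → ℂ) → (Fin m → ℂ)) (S : Set (Fin n → ℂ)) : Set ℝ≥0 :=
  {ν | ∃ A : ℝ, 0 < A ∧ ∃ B : ℝ, 0 < B ∧ ∀ z ∈ S, ‖z‖ < B → A * ‖z‖ ^ (ν : ℝ) ≤ ‖F z‖}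

/-- The local Łojasiewicz exponent of `F|S` at the origin: the infimum of `N(F|S)` in `[0, ∞]`,
so that it is `∞` when `N(F|S)` is empty. -/
noncomputable def lojasiewiczExponent {n m : ℕ} (F : (Fin n → ℂ) → (Fin m → ℂ))
    (S : Set (Fin n → ℂ)) : ℝ≥0∞ :=
  sInf ((fun ν : ℝ≥0 => (ν : ℝ≥0∞)) '' lojasiewiczSet F S)

/-!
It suffices to show that a bound `A * ‖z‖ ^ ν ≤ ‖F z‖` on the zero set `S` of `∏ j, F z j` near `0`
implies such a bound, with the same `ν`, on a full neighbourhood of `0`. If some component vanishes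
identically near `0`, then `S` contains a neighbourhood of `0`, so suppose that none does.

**Choice of a direction.** For a holomorphic `f` that is not locally zero, the order of vanishing of
`t ↦ f (t • x)` at `0` is constant for `x` in some nonempty open set of directions, and there
`‖f (t • x)‖` is comparable to `‖t‖ ^ d` (`exists_open_cone_bounds`). Shrinking this set once for
each component gives a direction `v` and a cone around it on which this holds for all components
(`exists_common_cone_bounds`). Fix a functional `ℓ` with `ℓ v = 1` and write `z = y + t • v` with
`ℓ y = 0`.

**Moving to the nearest zero.** By the bounds on the cone, each `t ↦ F (y + t • v) i` is bounded
below on an annulus, uniformly for small `y`. So it is a zero-free function of bounded distortion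
times a product of a bounded number of factors `t - ζ`, where `ζ` runs over its zeros
(`exists_roots_comparison`). Let `ζ` be the zero nearest to `t` among the zeros of all components.
For every zero `ξ`, `‖ζ - ξ‖ ≤ 2 * ‖t - ξ‖`, hence `‖F (y + ζ • v)‖ ≤ const * ‖F (y + t • v)‖`
(`exists_nearest_zero_comparison`). As `y + ζ • v` is in `S` and has norm at least a constant times
`‖y‖`, this bounds `‖F z‖` below by a constant times `‖y‖ ^ ν`.

**Conclusion.** Outside the cone `‖z‖ ≤ const * ‖y‖`, and this is the claim. Inside the cone all
values of `F` at points with the same `t` are comparable (`exists_cone_comparison`), so `z` may be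
replaced by a point `t • (v + ε • u)` with `ℓ u = 0`, whose kernel component is of size `‖t‖`; such
a `u ≠ 0` exists because `n ≥ 2` (`exists_bound_of_bound_on_zeros`).
-/

open Metric Set Filter Topology

/-! ### Factoring out the zeros of a function of one variable -/

theorem List.pow_length_le_norm_prod_sub {L : List ℂ} {a : ℝ} {t : ℂ} (ha : 0 ≤ a)
    (h : ∀ ζ ∈ L, a ≤ ‖t - ζ‖) : a ^ L.length ≤ ‖(L.map fun ζ => t - ζ).prod‖ := by
  induction L with
  | nil => simp
  | cons ζ L ih =>
    simp only [List.mem_cons, forall_eq_or_imp] at h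
    simp only [List.length_cons, List.map_cons, List.prod_cons, norm_mul, pow_succ']
    exact mul_le_mul h.1 (ih h.2) (by positivity) (by positivity)

theorem List.norm_prod_sub_le_pow_length_mul {L : List ℂ} {b : ℝ} {s t : ℂ}
    (h : ∀ ζ ∈ L, ‖s - ζ‖ ≤ b * ‖t - ζ‖) :
    ‖(L.map fun ζ => s - ζ).prod‖ ≤ b ^ L.length * ‖(L.map fun ζ => t - ζ).prod‖ := by
  induction L with
  | nil => simp
  | cons ζ L ih =>
    simp only [List.mem_cons, forall_eq_or_imp] at h
    simp only [List.length_cons, List.map_cons, List.prod_cons, norm_mul, pow_succ']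
    calc _ ≤ (b * ‖t - ζ‖) * (b ^ L.length * ‖(L.map fun ζ => t - ζ).prod‖) :=
          mul_le_mul h.1 (ih h.2) (by positivity) ((norm_nonneg _).trans h.1)
      _ = _ := by ring

theorem List.norm_prod_sub_le_pow_length {L : List ℂ} {b : ℝ} {t : ℂ}
    (h : ∀ ζ ∈ L, ‖t - ζ‖ ≤ b) : ‖(L.map fun ζ => t - ζ).prod‖ ≤ b ^ L.length := by
  induction L with
  | nil => simp
  | cons ζ L ih =>
    simp only [List.mem_cons, forall_eq_or_imp] at h
    simp only [List.length_cons, List.map_cons, List.prod_cons, norm_mul, pow_succ']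
    exact mul_le_mul h.1 (ih h.2) (by positivity) ((norm_nonneg _).trans h.1)

/-- The maximum principle on the closed disc of radius `R`. -/
theorem norm_le_of_forall_sphere {u : ℂ → ℂ} {R R' C : ℝ} (hR : 0 < R) (hRR : R < R')
    (hu : DifferentiableOn ℂ u (ball 0 R')) (hC : ∀ t, ‖t‖ = R → ‖u t‖ ≤ C) {t : ℂ}
    (ht : ‖t‖ ≤ R) : ‖u t‖ ≤ C := by
  refine Complex.norm_le_of_forall_mem_frontier_norm_le (U := ball 0 R) isBounded_ball ?_ ?_ ?_
  · refine (hu.mono ?_).diffContOnCl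
    rw [closure_ball _ hR.ne']
    exact closedBall_subset_ball hRR
  · intro z hz
    rw [frontier_ball _ hR.ne'] at hz
    exact hC z (by simpa using hz)
  · rw [closure_ball _ hR.ne']
    simpa using ht

theorem exists_mul_sub_of_eq_zero {u : ℂ → ℂ} {R : ℝ} {ζ : ℂ}
    (hu : DifferentiableOn ℂ u (ball 0 R)) (hζ : ‖ζ‖ < R) (h0 : u ζ = 0) :
    ∃ w : ℂ → ℂ, DifferentiableOn ℂ w (ball 0 R) ∧ ∀ t, u t = (t - ζ) * w t := by
  refine ⟨dslope u ζ, ?_, fun t => ?_⟩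
  · exact (Complex.differentiableOn_dslope (isOpen_ball.mem_nhds (by simpa using hζ))).2 hu
  · simpa [h0] using (sub_smul_dslope u ζ t).symm

/-- The zeros of `g` in the disc of radius `R` can be divided out, and their number is bounded in
terms of `M / μ`. With `N` zeros, all of modulus less than `R / 5`, the maximum principle for the
quotient `u`, applied at `R / 5` and on the circle of radius `R`, gives `μ / (2 * R / 5) ^ N ≤ M /
(4 * R / 5) ^ N`; hence `N ≤ 2 ^ N ≤ M / μ`, and a factorization with the largest possible number
of factors has a zero-free quotient. -/
theorem exists_factorization {g : ℂ → ℂ} {R M μ : ℝ} (hR : 0 < R) (hμ : 0 < μ)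
    (hg : DifferentiableOn ℂ g (ball 0 (2 * R))) (hM : ∀ t, ‖t‖ ≤ R → ‖g t‖ ≤ M)
    (hlow : ∀ t, R / 5 ≤ ‖t‖ → ‖t‖ ≤ R → μ ≤ ‖g t‖) :
    ∃ (Z : List ℂ) (u : ℂ → ℂ), Z.length ≤ ⌈M / μ⌉₊ ∧ (∀ ζ ∈ Z, ‖ζ‖ < R / 5) ∧
      DifferentiableOn ℂ u (ball 0 (2 * R)) ∧ (∀ t, ‖t‖ ≤ R → u t ≠ 0) ∧
      ∀ t, g t = u t * (Z.map fun ζ => t - ζ).prod := by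
  let P : ℕ → Prop := fun N => ∃ (Z : List ℂ) (u : ℂ → ℂ), Z.length = N ∧
    (∀ ζ ∈ Z, ‖ζ‖ < R / 5) ∧ DifferentiableOn ℂ u (ball 0 (2 * R)) ∧
      ∀ t, g t = u t * (Z.map fun ζ => t - ζ).prod
  have hbound : ∀ N, P N → N ≤ ⌈M / μ⌉₊ := by
    rintro N ⟨Z, u, rfl, hZ, hu, hgu⟩
    set N := Z.length
    have hup : ∀ t : ℂ, ‖t‖ = R → ‖u t‖ ≤ M / (4 * R / 5) ^ N := by
      intro t ht
      rw [le_div_iff₀ (by positivity)]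
      calc ‖u t‖ * (4 * R / 5) ^ N ≤ ‖u t‖ * ‖(Z.map fun ζ => t - ζ).prod‖ := by
            gcongr
            refine List.pow_length_le_norm_prod_sub (by positivity) fun ζ hζ => ?_
            have := norm_sub_norm_le t ζ
            have := hZ ζ hζ
            linarith
        _ = ‖g t‖ := by rw [hgu, norm_mul]
        _ ≤ M := hM t ht.le
    have hn : ‖((R / 5 : ℝ) : ℂ)‖ = R / 5 := by
      rw [Complex.norm_real, Real.norm_of_nonneg (by positivity)]
    have h1 := norm_le_of_forall_sphere hR (by linarith) hu hup (t := ((R / 5 : ℝ) : ℂ))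
      (by rw [hn]; linarith)
    have h2 : μ ≤ ‖u ((R / 5 : ℝ) : ℂ)‖ * (2 * R / 5) ^ N := by
      calc μ ≤ ‖g ((R / 5 : ℝ) : ℂ)‖ := hlow _ hn.ge (by rw [hn]; linarith)
        _ = ‖u ((R / 5 : ℝ) : ℂ)‖ * ‖(Z.map fun ζ => ((R / 5 : ℝ) : ℂ) - ζ).prod‖ := by
            rw [hgu, norm_mul]
        _ ≤ _ := by
            gcongr
            refine List.norm_prod_sub_le_pow_length fun ζ hζ => ?_
            have := norm_sub_le ((R / 5 : ℝ) : ℂ) ζ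
            have := hZ ζ hζ
            linarith
    have h3 : μ * 2 ^ N ≤ M := by
      have h4 : (4 * R / 5) ^ N = 2 ^ N * (2 * R / 5) ^ N := by
        rw [← mul_pow]; congr 1; ring
      have h5 : (0 : ℝ) < (2 * R / 5) ^ N := by positivity
      rw [le_div_iff₀ (by positivity), h4] at h1
      calc μ * 2 ^ N ≤ ‖u ((R / 5 : ℝ) : ℂ)‖ * (2 * R / 5) ^ N * 2 ^ N := by gcongr
        _ ≤ M := by linarith
    have h6 : (N : ℝ) ≤ M / μ := by
      rw [le_div_iff₀ hμ]
      have : (N : ℝ) ≤ 2 ^ N := by exact_mod_cast Nat.lt_two_pow_self.le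
      nlinarith
    exact_mod_cast h6.trans (Nat.le_ceil _)
  have h0 : P 0 := ⟨[], g, rfl, by simp, hg, by simp⟩
  classical
  obtain ⟨Z, u, hN, hZ, hu, hgu⟩ := Nat.findGreatest_spec (P := P) (Nat.zero_le _) h0
  refine ⟨Z, u, hN ▸ Nat.findGreatest_le _, hZ, hu, fun t ht hut => ?_, hgu⟩
  have ht5 : ‖t‖ < R / 5 := by
    by_contra! h
    have := hlow t h ht
    rw [hgu, hut, zero_mul, norm_zero] at this
    linarith
  obtain ⟨w, hw, huw⟩ := exists_mul_sub_of_eq_zero hu (ht.trans_lt (by linarith)) hut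
  have hP : P (Z.length + 1) := ⟨t :: Z, w, by simp, by simpa using ⟨ht5, hZ⟩, hw, fun s => by
    rw [hgu, huw, List.map_cons, List.prod_cons]; ring⟩
  have := Nat.le_findGreatest (hbound _ hP) hP
  omega

/-- If `s` is at most twice as far as `t` from each zero of `g` in the disc, then `‖g s‖` is at
most a constant times `‖g t‖`, with a constant that does not depend on `g`. The list `Z` may be
empty, and then the condition on `s` and `t` is void. -/
theorem exists_roots_comparison {R M μ : ℝ} (hR : 0 < R) (hM : 0 < M) (hμ : 0 < μ) :
    ∃ c : ℝ, 0 < c ∧ ∀ g : ℂ → ℂ, DifferentiableOn ℂ g (ball 0 (2 * R)) →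
      (∀ t, ‖t‖ ≤ R → ‖g t‖ ≤ M) → (∀ t, R / 5 ≤ ‖t‖ → ‖t‖ ≤ R → μ ≤ ‖g t‖) →
      ∃ Z : List ℂ, (∀ ζ ∈ Z, ‖ζ‖ < R / 5 ∧ g ζ = 0) ∧
        ∀ s t, ‖s‖ ≤ R → ‖t‖ ≤ R → (∀ ζ ∈ Z, ‖s - ζ‖ ≤ 2 * ‖t - ζ‖) → c * ‖g s‖ ≤ ‖g t‖ := by
  refine ⟨(M / μ * 3 ^ ⌈M / μ⌉₊)⁻¹, by positivity, fun g hg hgM hlow => ?_⟩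
  obtain ⟨Z, u, hN, hZ, hu, hu0, hgu⟩ := exists_factorization hR hμ hg hgM hlow
  refine ⟨Z, fun ζ hζ => ⟨hZ ζ hζ, ?_⟩, fun s t hs ht hst => ?_⟩
  · rw [hgu, List.prod_eq_zero, mul_zero]
    exact List.mem_map.2 ⟨ζ, hζ, sub_self ζ⟩
  set N := Z.length
  have hup : ‖u s‖ ≤ M / (4 * R / 5) ^ N := by
    refine norm_le_of_forall_sphere hR (by linarith) hu (fun t ht => ?_) hs
    rw [le_div_iff₀ (by positivity)]
    calc ‖u t‖ * (4 * R / 5) ^ N ≤ ‖u t‖ * ‖(Z.map fun ζ => t - ζ).prod‖ := by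
          gcongr
          refine List.pow_length_le_norm_prod_sub (by positivity) fun ζ hζ => ?_
          have := norm_sub_norm_le t ζ
          have := hZ ζ hζ
          linarith
      _ = ‖g t‖ := by rw [hgu, norm_mul]
      _ ≤ M := hgM t ht.le
  -- the minimum modulus of the zero-free function `u`, as the maximum modulus of its inverse
  have hdown : ‖u t‖⁻¹ ≤ (6 * R / 5) ^ N / μ := by
    have hcont : ∀ t, ‖t‖ < 2 * R → DifferentiableAt ℂ u t := fun t ht =>
      hu.differentiableAt (isOpen_ball.mem_nhds (by simpa using ht))
    rw [← norm_inv]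
    refine Complex.norm_le_of_forall_mem_frontier_norm_le (U := ball 0 R) (f := fun t => (u t)⁻¹)
      isBounded_ball ?_ ?_ ?_
    · refine DifferentiableOn.diffContOnCl ?_
      rw [closure_ball _ hR.ne']
      intro z hz
      have hz : ‖z‖ ≤ R := by simpa using hz
      exact ((hcont z (by linarith)).inv (hu0 z hz)).differentiableWithinAt
    · intro z hz
      rw [frontier_ball _ hR.ne'] at hz
      have hz : ‖z‖ = R := by simpa using hz
      have hpos : 0 < ‖u z‖ := norm_pos_iff.2 (hu0 z hz.le)
      rw [norm_inv, inv_le_comm₀ hpos (by positivity), inv_div, div_le_iff₀ (by positivity)]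
      calc μ ≤ ‖g z‖ := hlow z (by linarith) hz.le
        _ = ‖u z‖ * ‖(Z.map fun ζ => z - ζ).prod‖ := by rw [hgu, norm_mul]
        _ ≤ _ := by
            gcongr
            refine List.norm_prod_sub_le_pow_length fun ζ hζ => ?_
            have := norm_sub_le z ζ
            have := hZ ζ hζ
            linarith
    · rw [closure_ball _ hR.ne']
      simpa using ht
  have hprod := List.norm_prod_sub_le_pow_length_mul hst
  have hpos : 0 < ‖u t‖ := norm_pos_iff.2 (hu0 t ht)
  have hR' : (6 * R / 5) ^ N * 2 ^ N = 3 ^ N * (4 * R / 5) ^ N := by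
    rw [← mul_pow, ← mul_pow]; congr 1; ring
  rw [inv_mul_le_iff₀ (by positivity)]
  calc ‖g s‖ = ‖u s‖ * ‖u t‖⁻¹ * ‖(Z.map fun ζ => s - ζ).prod‖ * ‖u t‖ := by
        rw [hgu, norm_mul]; field_simp
    _ ≤ M / (4 * R / 5) ^ N * ((6 * R / 5) ^ N / μ) *
          (2 ^ N * ‖(Z.map fun ζ => t - ζ).prod‖) * ‖u t‖ := by gcongr
    _ = M / μ * 3 ^ N * ‖g t‖ := by
        rw [hgu t, norm_mul]
        have : (6 * R / 5) ^ N = 3 ^ N * (4 * R / 5) ^ N / 2 ^ N := by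
          rw [← hR']; field_simp
        rw [this]; field_simp
    _ ≤ M / μ * 3 ^ ⌈M / μ⌉₊ * ‖g t‖ := by
        gcongr
        norm_num

/-- A holomorphic function that is not locally zero is `t ^ k * h t` with `h 0 ≠ 0`, where `h` is
holomorphic on the whole original disc. -/
theorem eventually_eq_zero_or_exists_pow_mul {g : ℂ → ℂ} {R : ℝ} (hR : 0 < R)
    (hg : DifferentiableOn ℂ g (ball 0 R)) :
    (∀ᶠ t in 𝓝 0, g t = 0) ∨ ∃ (k : ℕ) (h : ℂ → ℂ), DifferentiableOn ℂ h (ball 0 R) ∧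
      (∀ t, g t = t ^ k * h t) ∧ h 0 ≠ 0 := by
  by_contra! hcon
  obtain ⟨hne, hcon⟩ := hcon
  have hdiv : ∀ k : ℕ, ∃ h : ℂ → ℂ, DifferentiableOn ℂ h (ball 0 R) ∧ ∀ t, g t = t ^ k * h t := by
    intro k
    induction k with
    | zero => exact ⟨g, hg, by simp⟩
    | succ k ih =>
      obtain ⟨h, hh, hgh⟩ := ih
      obtain ⟨w, hw, hhw⟩ := exists_mul_sub_of_eq_zero hh (by simpa using hR) (hcon k h hh hgh)
      exact ⟨w, hw, fun t => by rw [hgh, hhw]; ring⟩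
  have hana : ∀ {h : ℂ → ℂ}, DifferentiableOn ℂ h (ball 0 R) → AnalyticAt ℂ h 0 := fun hh =>
    hh.analyticAt (ball_mem_nhds _ hR)
  have htop : analyticOrderAt g 0 = ⊤ := by
    refine ENat.eq_top_iff_forall_ge.2 fun k => ?_
    obtain ⟨h, hh, hgh⟩ := hdiv k
    exact (natCast_le_analyticOrderAt (hana hg)).2
      ⟨h, hana hh, Eventually.of_forall fun t => by simpa using hgh t⟩
  exact hne (by simpa using analyticOrderAt_eq_top.1 htop)


/-! ### Behaviour along lines through the origin -/

section NormedSpace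

variable {E : Type*} [NormedAddCommGroup E] [NormedSpace ℂ E]

theorem differentiableOn_comp_line {f : E → ℂ} {s : Set E} (hf : DifferentiableOn ℂ f s) (x y : E)
    {T : Set ℂ} (hT : ∀ t ∈ T, x + t • y ∈ s) : DifferentiableOn ℂ (fun t : ℂ => f (x + t • y)) T :=
  hf.comp (by fun_prop) hT

/-- The identity theorem on a ball of a normed space, by restriction to complex lines. -/
theorem eqOn_zero_ball_of_eventually {f : E → ℂ} {ρ : ℝ} (hf : DifferentiableOn ℂ f (ball 0 ρ))
    {p : E} (hp : p ∈ ball 0 ρ) (h0 : ∀ᶠ z in 𝓝 p, f z = 0) : ∀ q ∈ ball 0 ρ, f q = 0 := by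
  intro q hq
  let φ : ℂ → E := fun t => p + t • (q - p)
  have hφ : Continuous φ := by fun_prop
  have hopen : IsOpen (φ ⁻¹' ball 0 ρ) := isOpen_ball.preimage hφ
  have hconv : Convex ℝ (φ ⁻¹' ball 0 ρ) := by
    intro a ha b hb s t hs ht hst
    have key : φ (s • a + t • b) = s • φ a + t • φ b := by
      have h1 : p = s • p + t • p := by rw [← add_smul, hst, one_smul]
      simp only [φ]
      nth_rewrite 1 [h1]
      simp only [add_smul, smul_add, smul_assoc]
      abel
    rw [mem_preimage, key]
    exact convex_ball (0 : E) ρ ha hb hs ht hst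
  have hana : AnalyticOnNhd ℂ (fun t => f (φ t)) (φ ⁻¹' ball 0 ρ) :=
    (differentiableOn_comp_line hf p (q - p) fun t ht => ht).analyticOnNhd hopen
  have hev : (fun t => f (φ t)) =ᶠ[𝓝 0] 0 := by
    have : Tendsto φ (𝓝 0) (𝓝 p) := by simpa [φ] using hφ.tendsto 0
    exact this.eventually h0
  have := hana.eqOn_zero_of_preconnected_of_eventuallyEq_zero hconv.isPreconnected
    (by simpa [φ] using hp) hev (x := 1) (by simpa [φ] using hq)
  simpa [φ] using this

/-- In some open set of directions `x`, the function `t ↦ f (t • x)` vanishes at `0` to a constant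
order `d`, with uniform two-sided bounds. Take `v ∈ V` for which the order `d` is minimal. For `x`
near `v` the quotient `f (t • x) / t ^ d` is still holomorphic, and it is close to `f (t • v) / t ^
d` on a small circle, hence on the disc inside it. -/
theorem exists_open_cone_bounds {f : E → ℂ} {ρ : ℝ} (hρ : 0 < ρ)
    (hf : DifferentiableOn ℂ f (ball 0 ρ)) (hne : ¬ ∀ᶠ z in 𝓝 0, f z = 0) {V : Set E}
    (hV : IsOpen V) (hV' : V.Nonempty) :
    ∃ W ⊆ V, IsOpen W ∧ W.Nonempty ∧ ∃ r : ℝ, 0 < r ∧ ∃ c : ℝ, 0 < c ∧ ∃ (C : ℝ) (d : ℕ),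
      ∀ x ∈ W, ∀ t : ℂ, ‖t‖ < r → c * ‖t‖ ^ d ≤ ‖f (t • x)‖ ∧ ‖f (t • x)‖ ≤ C * ‖t‖ ^ d := by
  classical
  obtain ⟨v₀, hv₀⟩ := hV'
  -- on bounded directions, `t ↦ f (t • x)` is defined on a disc of radius independent of `x`
  set V₁ := V ∩ ball v₀ 1 with hV₁
  have hV₁o : IsOpen V₁ := hV.inter isOpen_ball
  set R := ρ / (‖v₀‖ + 1) with hRdef
  have hR : 0 < R := by positivity
  have hmem : ∀ x ∈ V₁, ∀ t ∈ ball (0 : ℂ) R, t • x ∈ ball (0 : E) ρ := by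
    intro x hx t ht
    have hx : ‖x‖ < ‖v₀‖ + 1 := by
      have h1 := mem_ball_iff_norm.1 hx.2
      have h2 := norm_sub_norm_le x v₀
      linarith
    rw [mem_ball_zero_iff] at ht ⊢
    rw [norm_smul]
    calc ‖t‖ * ‖x‖ ≤ ‖t‖ * (‖v₀‖ + 1) := by gcongr
      _ < R * (‖v₀‖ + 1) := by gcongr
      _ = ρ := by rw [hRdef]; field_simp
  have hdiff : ∀ x ∈ V₁, DifferentiableOn ℂ (fun t : ℂ => f (t • x)) (ball 0 R) := by
    intro x hx
    simpa using differentiableOn_comp_line hf 0 x (T := ball 0 R) (by simpa using hmem x hx)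
  let P : ℕ → Prop := fun k => ∃ x ∈ V₁, ∃ h : ℂ → ℂ, DifferentiableOn ℂ h (ball 0 R) ∧
      (∀ t : ℂ, f (t • x) = t ^ k * h t) ∧ h 0 ≠ 0
  have hP : ∃ k, P k := by
    by_contra! hcon
    -- otherwise `f` vanishes on the cone over `V₁`, which has interior points
    apply hne
    have hzero : ∀ x ∈ V₁, ∀ t ∈ ball (0 : ℂ) R, f (t • x) = 0 := by
      intro x hx t ht
      rcases eventually_eq_zero_or_exists_pow_mul hR (hdiff x hx) with h | ⟨k, h, hh⟩
      · exact eqOn_zero_ball_of_eventually (hdiff x hx) (mem_ball_self hR) h t ht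
      · exact absurd ⟨x, hx, h, hh⟩ (hcon k)
    set τ : ℂ := ((R / 2 : ℝ) : ℂ) with hτ
    have hτ0 : τ ≠ 0 := by
      rw [hτ]; exact_mod_cast (by positivity : R / 2 ≠ 0)
    have hτR : τ ∈ ball (0 : ℂ) R := by
      rw [mem_ball_zero_iff, hτ, Complex.norm_real, Real.norm_of_nonneg (by positivity)]
      linarith
    have hv₁ : v₀ ∈ V₁ := ⟨hv₀, mem_ball_self one_pos⟩
    have hev : ∀ᶠ z in 𝓝 (τ • v₀), f z = 0 := by
      have hc : Tendsto (fun z : E => τ⁻¹ • z) (𝓝 (τ • v₀)) (𝓝 v₀) := by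
        have : Continuous fun z : E => τ⁻¹ • z := by fun_prop
        simpa [smul_smul, hτ0] using this.tendsto (τ • v₀)
      filter_upwards [hc.eventually (hV₁o.mem_nhds hv₁)] with z hz
      simpa [smul_smul, hτ0] using hzero _ hz τ hτR
    filter_upwards [ball_mem_nhds (0 : E) hρ] with z hz
    exact eqOn_zero_ball_of_eventually hf (hmem v₀ hv₁ τ hτR) hev z hz
  obtain ⟨v, hv, h, hh, hfh, hh0⟩ := Nat.find_spec hP
  set d := Nat.find hP with hd
  have hdiv : ∀ x ∈ V₁, ∀ k ≤ d, ∃ w : ℂ → ℂ, DifferentiableOn ℂ w (ball 0 R) ∧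
      ∀ t : ℂ, f (t • x) = t ^ k * w t := by
    intro x hx k
    induction k with
    | zero => exact fun _ => ⟨_, hdiff x hx, by simp⟩
    | succ k ih =>
      intro hk
      obtain ⟨w, hw, hfw⟩ := ih (by omega)
      have hw0 : w 0 = 0 := by
        by_contra hw0
        exact Nat.find_min hP (m := k) (by omega) ⟨x, hx, w, hw, hfw, hw0⟩
      obtain ⟨w', hw', hww'⟩ := exists_mul_sub_of_eq_zero hw (by simpa using hR) hw0
      exact ⟨w', hw', fun t => by rw [hfw, hww']; ring⟩
  set a := ‖h 0‖ / 4 with ha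
  have ha0 : 0 < a := by positivity
  obtain ⟨r, hr0, hrR, hr⟩ : ∃ r, 0 < r ∧ r < R ∧ ∀ t : ℂ, ‖t‖ ≤ r → ‖h t - h 0‖ < 2 * a := by
    have hc : ContinuousAt h 0 :=
      (hh.differentiableAt (ball_mem_nhds _ hR)).continuousAt
    obtain ⟨δ, hδ, hδ'⟩ := Metric.continuousAt_iff.1 hc (2 * a) (by positivity)
    refine ⟨min (δ / 2) (R / 2), by positivity, (min_le_right _ _).trans_lt (by linarith), ?_⟩
    intro t ht
    rw [← dist_eq_norm]
    apply hδ'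
    rw [dist_zero_right]
    exact (ht.trans (min_le_left _ _)).trans_lt (by linarith)
  have hnear : ∀ᶠ x in 𝓝 v, ∀ t ∈ sphere (0 : ℂ) r, ‖f (t • x) - f (t • v)‖ < a * r ^ d := by
    refine (isCompact_sphere (0 : ℂ) r).eventually_forall_of_forall_eventually fun t ht => ?_
    have htR : t ∈ ball (0 : ℂ) R := by
      rw [mem_ball_zero_iff, mem_sphere_zero_iff_norm.1 ht]; exact hrR
    have hcf : ContinuousAt f (t • v) :=
      (hf.differentiableAt (isOpen_ball.mem_nhds (hmem v hv t htR))).continuousAt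
    have h1 : ContinuousAt (fun p : E × ℂ => f (p.2 • p.1) - f (p.2 • v)) (v, t) := by
      refine ContinuousAt.sub ?_ ?_
      · exact ContinuousAt.comp (f := fun p : E × ℂ => p.2 • p.1) hcf (by fun_prop)
      · exact ContinuousAt.comp (f := fun p : E × ℂ => p.2 • v) hcf (by fun_prop)
    refine h1.norm.eventually_lt continuousAt_const ?_
    simpa using by positivity
  obtain ⟨W', hW', hW'o, hvW'⟩ := _root_.eventually_nhds_iff.1 hnear
  refine ⟨W' ∩ V₁, inter_subset_right.trans inter_subset_left, hW'o.inter hV₁o, ⟨v, hvW', hv⟩,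
    r, hr0, a, ha0, 7 * a, d, fun x hx t ht => ?_⟩
  obtain ⟨w, hw, hfw⟩ := hdiv x hx.2 d le_rfl
  have hclose : ‖w t - h t‖ ≤ a := by
    refine norm_le_of_forall_sphere (u := fun t => w t - h t) hr0 hrR (hw.sub hh)
      (fun s hs => ?_) ht.le
    have h1 := (hW' x hx.1 s (by simpa using hs)).le
    rw [hfw, hfh, ← mul_sub, norm_mul, norm_pow, hs, mul_comm] at h1
    exact le_of_mul_le_mul_right h1 (by positivity)
  have h2 := hr t ht.le
  have h3 : a ≤ ‖w t‖ ∧ ‖w t‖ ≤ 7 * a := by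
    have h4 : w t - h 0 = (w t - h t) + (h t - h 0) := by ring
    have h5 : ‖w t - h 0‖ ≤ 3 * a := by
      rw [h4]; exact (norm_add_le _ _).trans (by linarith)
    have h6 := abs_le.1 (abs_norm_sub_norm_le (w t) (h 0))
    constructor <;> linarith [h6.1, h6.2]
  rw [hfw, norm_mul, norm_pow, mul_comm (‖t‖ ^ d)]
  exact ⟨by gcongr; exact h3.1, by gcongr; exact h3.2⟩

theorem exists_common_cone_bounds {ι : Type*} (s : Finset ι) {f : ι → E → ℂ} {ρ : ℝ} (hρ : 0 < ρ)
    (hf : ∀ i, DifferentiableOn ℂ (f i) (ball 0 ρ)) (hne : ∀ i, ¬ ∀ᶠ z in 𝓝 0, f i z = 0)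
    {V : Set E} (hV : IsOpen V) (hV' : V.Nonempty) :
    ∃ W ⊆ V, IsOpen W ∧ W.Nonempty ∧ ∃ r : ℝ, 0 < r ∧ ∀ i ∈ s, ∃ c : ℝ, 0 < c ∧
      ∃ (C : ℝ) (d : ℕ), ∀ x ∈ W, ∀ t : ℂ, ‖t‖ < r →
        c * ‖t‖ ^ d ≤ ‖f i (t • x)‖ ∧ ‖f i (t • x)‖ ≤ C * ‖t‖ ^ d := by
  classical
  induction s using Finset.induction_on with
  | empty => exact ⟨V, subset_rfl, hV, hV', 1, one_pos, by simp⟩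
  | insert i s _ ih =>
    obtain ⟨W, hWV, hW, hW', r, hr, h⟩ := ih
    obtain ⟨W₁, hWW, hW₁, hW₁', r₁, hr₁, h₁⟩ := exists_open_cone_bounds hρ (hf i) (hne i) hW hW'
    refine ⟨W₁, hWW.trans hWV, hW₁, hW₁', min r r₁, lt_min hr hr₁, ?_⟩
    intro j hj
    rcases Finset.mem_insert.1 hj with rfl | hj
    · obtain ⟨c, hc, C, d, hb⟩ := h₁
      exact ⟨c, hc, C, d, fun x hx t ht => hb x hx t (ht.trans_le (min_le_right _ _))⟩
    · obtain ⟨c, hc, C, d, hb⟩ := h j hj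
      exact ⟨c, hc, C, d, fun x hx t ht => hb x (hWW hx) t (ht.trans_le (min_le_left _ _))⟩

/-! ### Comparison of values -/

/-- Among the zeros `ζ` of all components of `F` on the line `y + ℂ • v`, the one nearest to `t`
satisfies `κ * ‖F (y + ζ • v)‖ ≤ ‖F (y + t • v)‖`, uniformly in `y` and `t`. -/
theorem exists_nearest_zero_comparison {ι : Type*} [Fintype ι] [Nonempty ι] {F : E → ι → ℂ}
    {ρ M : ℝ} (hρ : 0 < ρ) (hM : 0 < M) (hF : DifferentiableOn ℂ F (ball 0 ρ))
    (hFM : ∀ z ∈ ball 0 ρ, ‖F z‖ ≤ M) (hF0 : F 0 = 0) {v : E} {ε r R : ℝ} (hε : 0 < ε)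
    (hcone : ∀ i, ∃ c : ℝ, 0 < c ∧ ∃ d : ℕ, ∀ x : E, ‖x - v‖ ≤ ε → ∀ t : ℂ, ‖t‖ < r →
      c * ‖t‖ ^ d ≤ ‖F (t • x) i‖)
    (hR : 0 < R) (hRr : R < r) (hRρ : 2 * R * ‖v‖ ≤ ρ / 2) :
    ∃ κ : ℝ, 0 < κ ∧ ∃ η : ℝ, 0 < η ∧ ∀ y : E, ‖y‖ < η → ∀ t : ℂ, ‖t‖ ≤ R →
      ∃ ζ : ℂ, ‖ζ‖ ≤ R ∧ ∏ i, F (y + ζ • v) i = 0 ∧ κ * ‖F (y + ζ • v)‖ ≤ ‖F (y + t • v)‖ := by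
  classical
  choose c hc d hcd using hcone
  choose κ hκ hroots using fun i =>
    exists_roots_comparison hR hM (μ := c i * (R / 5) ^ d i) (by have := hc i; positivity)
  have hline : ∀ y : E, ‖y‖ < ρ / 2 → ∀ t : ℂ, ‖t‖ ≤ 2 * R → y + t • v ∈ ball (0 : E) ρ := by
    intro y hy t ht
    rw [mem_ball_zero_iff]
    calc ‖y + t • v‖ ≤ ‖y‖ + ‖t‖ * ‖v‖ := (norm_add_le _ _).trans_eq (by rw [norm_smul])
      _ ≤ ‖y‖ + 2 * R * ‖v‖ := by gcongr
      _ < ρ := by linarith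
  have hFi : ∀ i, DifferentiableOn ℂ (fun z => F z i) (ball 0 ρ) := fun i =>
    differentiableOn_pi.1 hF i
  have hsmall : ∀ᶠ y in 𝓝 (0 : E), ∀ i, ‖F y i‖ < κ i * (c i * (R / 5) ^ d i) := by
    refine eventually_all.2 fun i => ?_
    have hcont : ContinuousAt (fun z => F z i) 0 :=
      ((hFi i).differentiableAt (ball_mem_nhds _ hρ)).continuousAt
    refine hcont.norm.eventually_lt continuousAt_const ?_
    have := hc i
    have := hκ i
    simpa [hF0] using by positivity
  obtain ⟨η₀, hη₀, hη₀'⟩ := Metric.eventually_nhds_iff.1 hsmall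
  obtain ⟨i₁, hi₁⟩ := Finite.exists_min κ
  refine ⟨κ i₁, hκ i₁, min η₀ (min (ρ / 2) (ε * (R / 5))), by positivity, fun y hy t ht => ?_⟩
  obtain ⟨hy₀, hy₁, hy₂⟩ : ‖y‖ < η₀ ∧ ‖y‖ < ρ / 2 ∧ ‖y‖ < ε * (R / 5) := by
    simpa only [lt_min_iff] using hy
  have hlow : ∀ i, ∀ s : ℂ, R / 5 ≤ ‖s‖ → ‖s‖ ≤ R → c i * (R / 5) ^ d i ≤ ‖F (y + s • v) i‖ := by
    intro i s hs hsR
    have hspos : 0 < ‖s‖ := by linarith [div_pos hR (by norm_num : (0 : ℝ) < 5)]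
    have hs0 : s ≠ 0 := norm_pos_iff.1 hspos
    have hx : ‖(v + s⁻¹ • y) - v‖ ≤ ε := by
      rw [add_sub_cancel_left, norm_smul, norm_inv, inv_mul_le_iff₀ hspos]
      calc ‖y‖ ≤ ε * (R / 5) := hy₂.le
        _ ≤ ε * ‖s‖ := by gcongr
        _ = ‖s‖ * ε := mul_comm _ _
    have hz : s • (v + s⁻¹ • y) = y + s • v := by
      rw [smul_add, smul_smul, mul_inv_cancel₀ hs0, one_smul, add_comm]
    have := hcd i _ hx s (by linarith)
    rw [hz] at this
    refine le_trans ?_ this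
    have := hc i
    gcongr
  choose Z hZ hZcomp using fun i => hroots i (fun s => F (y + s • v) i)
    (differentiableOn_comp_line (hFi i) y v fun s hs => hline y hy₁ s (mem_ball_zero_iff.1 hs).le)
    (fun s hs => (norm_le_pi_norm _ i).trans (hFM _ (hline y hy₁ s (by linarith)))) (hlow i)
  -- without zeros, the comparison of `0` with a boundary point contradicts the choice of `η₀`
  have hZne : ∀ i, Z i ≠ [] := by
    intro i hi
    have hn : ‖(R : ℂ)‖ = R := by rw [Complex.norm_real, Real.norm_of_nonneg hR.le]
    have h1 := hZcomp i (R : ℂ) 0 hn.le (by simpa using hR.le) (by simp [hi])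
    have h2 := hlow i (R : ℂ) (by rw [hn]; linarith) hn.le
    have h3 := hη₀' (y := y) (by simpa using hy₀) i
    have h4 := mul_le_mul_of_nonneg_left h2 (hκ i).le
    simp only [zero_smul, add_zero] at h1
    linarith
  let T : Finset ℂ := Finset.univ.biUnion fun i => (Z i).toFinset
  have hT : ∀ {ζ}, ζ ∈ T ↔ ∃ i, ζ ∈ Z i := by simp [T]
  have hTne : T.Nonempty := by
    obtain ⟨i⟩ := ‹Nonempty ι›
    obtain ⟨ζ, hζ⟩ := List.exists_mem_of_ne_nil _ (hZne i)
    exact ⟨ζ, hT.2 ⟨i, hζ⟩⟩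
  obtain ⟨ζ, hζT, hζmin⟩ := T.exists_min_image (fun ζ => ‖t - ζ‖) hTne
  obtain ⟨i₀, hi₀⟩ := hT.1 hζT
  obtain ⟨hζR, hζ0⟩ := hZ i₀ ζ hi₀
  refine ⟨ζ, by linarith, Finset.prod_eq_zero (Finset.mem_univ i₀) hζ0, ?_⟩
  rw [mul_comm, ← le_div_iff₀ (hκ i₁)]
  refine (pi_norm_le_iff_of_nonneg (by have := hκ i₁; positivity)).2 fun i => ?_
  rw [le_div_iff₀ (hκ i₁), mul_comm]
  calc κ i₁ * ‖F (y + ζ • v) i‖ ≤ κ i * ‖F (y + ζ • v) i‖ := by gcongr; exact hi₁ i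
    _ ≤ ‖F (y + t • v) i‖ := by
        refine hZcomp i ζ t (by linarith) ht fun ξ hξ => ?_
        have h1 := hζmin ξ (hT.2 ⟨i, hξ⟩)
        have h2 : ζ - ξ = (t - ξ) - (t - ζ) := by ring
        rw [h2]
        exact (norm_sub_le _ _).trans (by linarith)
    _ ≤ _ := norm_le_pi_norm _ i

theorem exists_cone_comparison {ι : Type*} [Fintype ι] [Nonempty ι] {F : E → ι → ℂ}
    {W : Set E} {r : ℝ}
    (hcone : ∀ i, ∃ c : ℝ, 0 < c ∧ ∃ (C : ℝ) (d : ℕ), ∀ x ∈ W, ∀ t : ℂ, ‖t‖ < r →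
      c * ‖t‖ ^ d ≤ ‖F (t • x) i‖ ∧ ‖F (t • x) i‖ ≤ C * ‖t‖ ^ d) :
    ∃ K : ℝ, 0 < K ∧ ∀ x ∈ W, ∀ y ∈ W, ∀ t : ℂ, ‖t‖ < r →
      K * ‖F (t • y)‖ ≤ ‖F (t • x)‖ := by
  choose c hc C d hcd using hcone
  let q : ι → ℝ := fun i => c i / (|C i| + 1)
  have hq : ∀ i, 0 < q i := fun i => div_pos (hc i) (by positivity)
  obtain ⟨i₁, hi₁⟩ := Finite.exists_min q
  refine ⟨q i₁, hq i₁, fun x hx y hy t ht => ?_⟩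
  rw [mul_comm, ← le_div_iff₀ (hq i₁)]
  refine (pi_norm_le_iff_of_nonneg (by have := hq i₁; positivity)).2 fun i => ?_
  rw [le_div_iff₀ (hq i₁), mul_comm]
  calc q i₁ * ‖F (t • y) i‖ ≤ q i * ((|C i| + 1) * ‖t‖ ^ d i) := by
        have h1 : C i ≤ |C i| + 1 := by linarith [le_abs_self (C i)]
        refine mul_le_mul (hi₁ i) (((hcd i y hy t ht).2).trans ?_) (norm_nonneg _) (hq i).le
        gcongr
    _ = c i * ‖t‖ ^ d i := by
        have : |C i| + 1 ≠ 0 := by positivity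
        simp only [q]; field_simp
    _ ≤ ‖F (t • x) i‖ := (hcd i x hx t ht).1
    _ ≤ _ := norm_le_pi_norm _ i

/-- A lower bound by `‖z‖ ^ ν` on the zero set of the product of the components propagates to a
neighbourhood of the origin. The hypothesis `hE` says that `E` has dimension at least two. -/
theorem exists_bound_of_bound_on_zeros {ι : Type*} [Fintype ι] [Nonempty ι] {F : E → ι → ℂ}
    {ρ : ℝ} (hρ : 0 < ρ) (hF : DifferentiableOn ℂ F (ball 0 ρ)) (hF0 : F 0 = 0)
    (hne : ∀ i, ¬ ∀ᶠ z in 𝓝 0, F z i = 0) (hE : ∀ ℓ : E →L[ℂ] ℂ, ∃ u, u ≠ 0 ∧ ℓ u = 0)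
    {ν A : ℝ} (hν : 0 ≤ ν) (hA : 0 < A)
    (hS : ∀ z ∈ ball 0 ρ, ∏ i, F z i = 0 → A * ‖z‖ ^ ν ≤ ‖F z‖) :
    ∃ A' : ℝ, 0 < A' ∧ ∃ B' : ℝ, 0 < B' ∧ ∀ z : E, ‖z‖ < B' → A' * ‖z‖ ^ ν ≤ ‖F z‖ := by
  -- shrink the ball so that `F` is bounded by `1`
  obtain ⟨ρ', hρ', hρρ, hFM⟩ : ∃ ρ', 0 < ρ' ∧ ρ' ≤ ρ ∧ ∀ z ∈ ball 0 ρ', ‖F z‖ ≤ 1 := by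
    have hcont : ContinuousAt F 0 := (hF.differentiableAt (ball_mem_nhds _ hρ)).continuousAt
    obtain ⟨δ, hδ, hδ'⟩ := Metric.continuousAt_iff.1 hcont 1 one_pos
    refine ⟨min δ ρ, by positivity, min_le_right _ _, fun z hz => ?_⟩
    have := hδ' (mem_ball.1 (ball_subset_ball (min_le_left _ _) hz))
    simpa [hF0] using this.le
  replace hF := hF.mono (ball_subset_ball hρρ)
  replace hS : ∀ z ∈ ball 0 ρ', ∏ i, F z i = 0 → A * ‖z‖ ^ ν ≤ ‖F z‖ := fun z hz =>
    hS z (ball_subset_ball hρρ hz)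
  obtain ⟨u₀, hu₀, -⟩ := hE 0
  obtain ⟨W, hW0, hW, ⟨v, hvW⟩, r, hr, hcone⟩ := exists_common_cone_bounds Finset.univ
    (f := fun i z => F z i) hρ' (fun i => differentiableOn_pi.1 hF i) hne
    (V := {0}ᶜ) isOpen_compl_singleton ⟨u₀, hu₀⟩
  have hv0 : v ≠ 0 := hW0 hvW
  obtain ⟨ε, hε, hεW⟩ := Metric.nhds_basis_closedBall.mem_iff.1 (hW.mem_nhds hvW)
  have hmemW : ∀ x, ‖x - v‖ ≤ ε → x ∈ W := fun x hx => hεW (by simpa [dist_eq_norm] using hx)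
  obtain ⟨K, hK, hcomp⟩ := exists_cone_comparison (F := F) (W := W) (r := r)
    fun i => hcone i (Finset.mem_univ i)
  have hv : 0 < ‖v‖ := norm_pos_iff.2 hv0
  set R := min (r / 2) (ρ' / (4 * ‖v‖)) with hRdef
  have hR : 0 < R := by positivity
  have hRr : R < r := (min_le_left _ _).trans_lt (by linarith)
  have hRρ : 2 * R * ‖v‖ ≤ ρ' / 2 := by
    calc 2 * R * ‖v‖ ≤ 2 * (ρ' / (4 * ‖v‖)) * ‖v‖ := by gcongr; exact min_le_right _ _
      _ = ρ' / 2 := by field_simp; norm_num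
  obtain ⟨κ, hκ, η₀, hη₀, hnear⟩ := exists_nearest_zero_comparison hρ' one_pos hF hFM hF0 hε
    (fun i => by
      obtain ⟨c, hc, C, d, h⟩ := hcone i (Finset.mem_univ i)
      exact ⟨c, hc, d, fun x hx t ht => (h x (hmemW x hx) t ht).1⟩) hR hRr hRρ
  obtain ⟨ℓ, hℓ⟩ := SeparatingDual.exists_eq_one (R := ℂ) hv0
  set Λ := 1 + ‖ℓ‖ * ‖v‖ with hΛ
  have hΛ0 : 0 < Λ := by positivity
  have hproj : ∀ z, ‖z - ℓ z • v‖ ≤ Λ * ‖z‖ := by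
    intro z
    calc ‖z - ℓ z • v‖ ≤ ‖z‖ + ‖ℓ z‖ * ‖v‖ := (norm_sub_le _ _).trans_eq (by rw [norm_smul])
      _ ≤ ‖z‖ + ‖ℓ‖ * ‖z‖ * ‖v‖ := by gcongr; exact ℓ.le_opNorm z
      _ = Λ * ‖z‖ := by rw [hΛ]; ring
  set η := min η₀ (ρ' / 2) with hη
  have hη0 : 0 < η := by positivity
  -- the bound away from the line through `v`, in terms of the component `y` in the kernel of `ℓ`
  have hbase : ∀ y, ℓ y = 0 → ‖y‖ < η → ∀ t : ℂ, ‖t‖ ≤ R →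
      κ * A * (‖y‖ / Λ) ^ ν ≤ ‖F (y + t • v)‖ := by
    intro y hy hyη t ht
    obtain ⟨ζ, hζ, hζ0, hle⟩ := hnear y (hyη.trans_le (min_le_left _ _)) t ht
    have hyw : ‖y‖ / Λ ≤ ‖y + ζ • v‖ := by
      rw [div_le_iff₀' hΛ0]
      have := hproj (y + ζ • v)
      simpa [hy, hℓ] using this
    have hw : y + ζ • v ∈ ball (0 : E) ρ' := by
      rw [mem_ball_zero_iff]
      have h1 : ‖y + ζ • v‖ ≤ ‖y‖ + ‖ζ‖ * ‖v‖ := (norm_add_le _ _).trans_eq (by rw [norm_smul])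
      have h2 : ‖ζ‖ * ‖v‖ ≤ R * ‖v‖ := by gcongr
      have h3 : ‖y‖ < ρ' / 2 := hyη.trans_le (min_le_right _ _)
      nlinarith [mul_pos hR hv]
    calc κ * A * (‖y‖ / Λ) ^ ν ≤ κ * A * ‖y + ζ • v‖ ^ ν := by gcongr
      _ = κ * (A * ‖y + ζ • v‖ ^ ν) := by ring
      _ ≤ κ * ‖F (y + ζ • v)‖ := by gcongr; exact hS _ hw hζ0
      _ ≤ _ := hle
  obtain ⟨u₁, hu₁, hℓu₁⟩ := hE ℓ
  set u : E := ((‖u₁‖ : ℂ))⁻¹ • u₁ with hu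
  have hun : ‖u‖ = 1 := norm_smul_inv_norm hu₁
  have hℓu : ℓ u = 0 := by rw [hu, map_smul, hℓu₁, smul_zero]
  set D := Λ * ((ε + ‖v‖) / ε) with hD
  have hD0 : 0 < D := by positivity
  set K' := min 1 K with hK'
  have hK'0 : 0 < K' := by positivity
  refine ⟨K' * (κ * A) * (D⁻¹) ^ ν, by positivity,
    min (η / Λ) (min (R / (‖ℓ‖ + 1)) (η / (ε * (‖ℓ‖ + 1)))), by positivity, fun z hz => ?_⟩
  obtain ⟨hz₁, hz₂, hz₃⟩ : ‖z‖ < η / Λ ∧ ‖z‖ < R / (‖ℓ‖ + 1) ∧ ‖z‖ < η / (ε * (‖ℓ‖ + 1)) := by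
    simpa only [lt_min_iff] using hz
  rw [lt_div_iff₀ (by positivity)] at hz₁ hz₂ hz₃
  set t := ℓ z with ht
  set y := z - t • v with hy
  have hzy : z = y + t • v := by rw [hy, sub_add_cancel]
  have hℓy : ℓ y = 0 := by simp [hy, hℓ, ht]
  have hyη : ‖y‖ < η := (hproj z).trans_lt (by linarith)
  have htz : ‖t‖ ≤ ‖z‖ * (‖ℓ‖ + 1) := by
    have := ℓ.le_opNorm z
    nlinarith [norm_nonneg z]
  have htR : ‖t‖ ≤ R := htz.trans hz₂.le
  have hεt : ε * ‖t‖ < η := by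
    calc ε * ‖t‖ ≤ ε * (‖z‖ * (‖ℓ‖ + 1)) := by gcongr
      _ < η := by linarith
  have hzn : ‖z‖ ≤ ‖y‖ + ‖t‖ * ‖v‖ := by
    rw [hzy]; exact (norm_add_le _ _).trans_eq (by rw [norm_smul])
  have hfinal : ∀ b : ℝ, 0 ≤ b → ‖z‖ * ε ≤ (ε + ‖v‖) * b →
      (D⁻¹) ^ ν * ‖z‖ ^ ν ≤ (b / Λ) ^ ν := by
    intro b hb hzb
    rw [← Real.mul_rpow (by positivity) (by positivity)]
    refine Real.rpow_le_rpow (by positivity) ?_ hν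
    rw [inv_mul_le_iff₀ hD0, hD]
    have : Λ * ((ε + ‖v‖) / ε) * (b / Λ) = (ε + ‖v‖) * b / ε := by field_simp
    rw [this, le_div_iff₀ hε]
    exact hzb
  rcases le_or_gt (ε * ‖t‖) ‖y‖ with hcase | hcase
  · have h1 := hbase y hℓy hyη t htR
    rw [← hzy] at h1
    have h2 := hfinal ‖y‖ (norm_nonneg _) <| by
      calc ‖z‖ * ε ≤ (‖y‖ + ‖t‖ * ‖v‖) * ε := by gcongr
        _ = ε * ‖y‖ + ε * ‖t‖ * ‖v‖ := by ring
        _ ≤ ε * ‖y‖ + ‖y‖ * ‖v‖ := by gcongr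
        _ = (ε + ‖v‖) * ‖y‖ := by ring
    calc K' * (κ * A) * (D⁻¹) ^ ν * ‖z‖ ^ ν = K' * (κ * A) * ((D⁻¹) ^ ν * ‖z‖ ^ ν) := by ring
      _ ≤ 1 * (κ * A) * (‖y‖ / Λ) ^ ν := by gcongr; exact min_le_left _ _
      _ ≤ ‖F z‖ := by rw [one_mul]; exact h1
  · -- near the line through `v`, move along the cone to a point with a large kernel component
    have ht0 : 0 < ‖t‖ := by
      by_contra! h
      have := norm_nonneg y
      nlinarith
    have ht0' : t ≠ 0 := norm_pos_iff.1 ht0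
    have hx : v + t⁻¹ • y ∈ W := by
      apply hmemW
      rw [add_sub_cancel_left, norm_smul, norm_inv, inv_mul_le_iff₀ ht0]
      linarith
    have hx' : v + (ε : ℂ) • u ∈ W := by
      apply hmemW
      rw [add_sub_cancel_left, norm_smul, hun, Complex.norm_real, Real.norm_of_nonneg hε.le,
        mul_one]
    have hzx : t • (v + t⁻¹ • y) = z := by
      rw [smul_add, smul_smul, mul_inv_cancel₀ ht0', one_smul, add_comm, ← hzy]
    have h0 := hcomp _ hx _ hx' t (htR.trans_lt hRr)
    rw [hzx] at h0
    set y' : E := (t * (ε : ℂ)) • u with hy'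
    have hy'n : ‖y'‖ = ε * ‖t‖ := by
      rw [hy', norm_smul, hun, norm_mul, Complex.norm_real, Real.norm_of_nonneg hε.le]; ring
    have hzx' : t • (v + (ε : ℂ) • u) = y' + t • v := by
      rw [smul_add, smul_smul, add_comm]
    rw [hzx'] at h0
    have h1 := hbase y' (by rw [hy', map_smul, hℓu, smul_zero]) (by rwa [hy'n]) t htR
    have h2 := hfinal ‖y'‖ (norm_nonneg _) <| by
      rw [hy'n]
      calc ‖z‖ * ε ≤ (ε * ‖t‖ + ‖t‖ * ‖v‖) * ε := by gcongr; linarith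
        _ = (ε + ‖v‖) * (ε * ‖t‖) := by ring
    calc K' * (κ * A) * (D⁻¹) ^ ν * ‖z‖ ^ ν = K' * (κ * A * ((D⁻¹) ^ ν * ‖z‖ ^ ν)) := by ring
      _ ≤ K * (κ * A * (‖y'‖ / Λ) ^ ν) := by gcongr; exact min_le_right _ _
      _ ≤ K * ‖F (y' + t • v)‖ := by gcongr
      _ ≤ ‖F z‖ := h0

end NormedSpace

/-! ### The Łojasiewicz exponent -/

theorem exists_ne_zero_map_eq_zero {n : ℕ} (hn : 2 ≤ n) (ℓ : (Fin n → ℂ) →L[ℂ] ℂ) :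
    ∃ u, u ≠ 0 ∧ ℓ u = 0 := by
  have h : ℓ.toLinearMap.ker ≠ ⊥ := LinearMap.ker_ne_bot_of_finrank_lt <| by
    simpa using Nat.lt_of_succ_le hn
  obtain ⟨u, hu, hu0⟩ := Submodule.exists_mem_ne_zero_of_ne_bot h
  exact ⟨u, hu0, hu⟩

theorem lojasiewiczSet_antitone {n m : ℕ} (F : (Fin n → ℂ) → (Fin m → ℂ)) {S T : Set (Fin n → ℂ)}
    (hST : S ⊆ T) : lojasiewiczSet F T ⊆ lojasiewiczSet F S := by
  rintro ν ⟨A, hA, B, hB, h⟩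
  exact ⟨A, hA, B, hB, fun z hz => h z (hST hz)⟩

theorem lojasiewiczSet_zeros_subset {n m : ℕ} (hn : 2 ≤ n) (hm : 1 ≤ m) {U : Set (Fin n → ℂ)}
    (hU : IsOpen U) (h0 : (0 : Fin n → ℂ) ∈ U) {F : (Fin n → ℂ) → (Fin m → ℂ)}
    (hF : DifferentiableOn ℂ F U) (hF0 : F 0 = 0) :
    lojasiewiczSet F {z | z ∈ U ∧ ∏ j, F z j = 0} ⊆ lojasiewiczSet F U := by
  rintro ν ⟨A, hA, B, hB, h⟩
  by_cases hne : ∀ i, ¬ ∀ᶠ z in 𝓝 0, F z i = 0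
  · have : Nonempty (Fin m) := ⟨⟨0, hm⟩⟩
    obtain ⟨ρ, hρ, hρU⟩ := Metric.isOpen_iff.1 hU 0 h0
    obtain ⟨A', hA', B', hB', h'⟩ := exists_bound_of_bound_on_zeros (ρ := min ρ B) (by positivity)
      (hF.mono ((ball_subset_ball (min_le_left _ _)).trans hρU)) hF0 hne
      (exists_ne_zero_map_eq_zero hn) ν.coe_nonneg hA fun z hz hz0 =>
        h z ⟨hρU (ball_subset_ball (min_le_left _ _) hz), hz0⟩
          ((mem_ball_zero_iff.1 hz).trans_le (min_le_right _ _))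
    exact ⟨A', hA', B', hB', fun z _ hz => h' z hz⟩
  · -- a component vanishes identically near `0`, so the zero set contains a neighbourhood of `0`
    push Not at hne
    obtain ⟨i, hi⟩ := hne
    obtain ⟨δ, hδ, hδ'⟩ := Metric.eventually_nhds_iff.1 hi
    refine ⟨A, hA, min B δ, by positivity, fun z hz hzn => ?_⟩
    refine h z ⟨hz, Finset.prod_eq_zero (Finset.mem_univ i) ?_⟩ (hzn.trans_le (min_le_left _ _))
    exact hδ' (by simpa using hzn.trans_le (min_le_right _ _))

theorem theorem1 (n m : ℕ) (hn : 2 ≤ n) (hm : 1 ≤ m) (U : Set (Fin n → ℂ)) (hU : IsOpen U)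
    (h0 : (0 : Fin n → ℂ) ∈ U) (F : (Fin n → ℂ) → (Fin m → ℂ)) (hF : DifferentiableOn ℂ F U)
    (hF0 : F 0 = 0) :
    lojasiewiczExponent F U = lojasiewiczExponent F {z | z ∈ U ∧ ∏ j, F z j = 0} := by
  unfold lojasiewiczExponent
  rw [(lojasiewiczSet_zeros_subset hn hm hU h0 hF hF0).antisymm
    (lojasiewiczSet_antitone F fun z hz => hz.1)]
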